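/- Let $V$ be a finite set with $|V|\ge 2$ and let $\Omega=\{\eta\in[0,1]^V:\sum_{x}\eta_x=1\}$. For distinct $x,y\in V$ and $u,v\in[0,1]$ let $\eta R^{uv}_{xy}\in\Omega$ be obtained from $\eta\in\Omega$ by replacing $(\eta_x,\eta_y)$ with $(u\eta_x+(1-v)\eta_y,\,(1-u)\eta_x+v\eta_y)$ and leaving the other coordinates unchanged. Let $(\beta_{xy})_{x,y\in V}$ be (possibly infinite) Borel measures on $[0,1]^2$ with $\beta_{xx}=0$ and $$\int_{[0,1]^2}\beta_{xy}(\mathrm du,\mathrm dv)\,\{(1-u)+(1-v)\}<\infty\qquad\text{for all }x,y\in V,$$ and consider the generator of the stochastic exchange model $$\mathcal L f(\eta)=\sum_{x,y\in V}\int_{[0,1]^2}\beta_{xy}(\mathrm du,\mathrm dv)\,\{f(\eta R^{uv}_{xy})-f(\eta)\},\qquad \eta\in\Omega .$$ For $k\ge 0$ let $\mathscr P_k$ be the space of functions $f:\Omega\to\mathbb C$ that are restrictions of complex polynomials of degree at most $k$; then $\mathcal L\mathscr P_k\subset\mathscr P_k$. For distinct $x,y\in V$ write $\bar\beta_{xy}(\mathrm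 du,\mathrm dv)=\beta_{xy}(\mathrm du,\mathrm dv)+\beta_{yx}(\mathrm dv,\mathrm du)$ and $$r_{xy}=\int_{[0,1]^2}\bar\beta_{xy}(\mathrm du,\mathrm dv)\,(1-u),\qquad s_{xy}=\int_{[0,1]^2}\bar\beta_{xy}(\mathrm du,\mathrm dv)\,u(1-u).$$ Assume that any two $x,y\in V$ are joined by a path $x=x_0,x_1,\dots,x_m=y$ with $m\ge 1$ and $s_{x_0x_1}s_{x_1x_2}\cdots s_{x_{m-1}x_m}>0$. Then the random walk on $V$ with jump rates $(r_{xy})_{x\ne y}$ is irreducible; let $\pi=(\pi_x)_{x\in V}$ be its unique invariant probability measure, i.e. $\sum_{y\ne x}\pi_y r_{yx}=\pi_x\sum_{y\ne x}r_{xy}$ for all $x$. For $x\neq y$ put $\pi_{xy}=\tfrac12(\pi_xr_{xy}+\pi_yr_{yx})$ and $$\chi_{xy}=\int_{[0,1]^2}\bar\beta_{xy}(\mathrm du,\mathrm dv)\,\big(\pi_x u(1-u)+\pi_y v(1-v)\big),$$ $$\sigma_{xy}=\int_{[0,1]^2}\bar\beta_{xy}(\mathrm du,\mathrm dv)\,\big(\pi_x(1-u)-\pi_y(1-v)\big)^2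 ,$$ and define $$\gamma(\mathcal L)=\min_{x\neq y\,:\,\pi_{xy}>0}\frac{\chi_{xy}+\sigma_{xy}}{\pi_{xy}},$$ $$\mathrm{gap}_{\rm RW}(\mathcal L)=\inf\Big\{\tfrac12\sum_{x\ne y}\pi_{xy}(\psi(y)-\psi(x))^2:\ \psi\in\mathbb R^V,\ \|\psi-\pi\psi\|_{L^2(\pi)}=1\Big\},\qquad \pi\psi=\sum_{x\in V}\pi_x\psi(x).$$ Theorem. Fix $k\ge 2$. If $\lambda\in\mathbb C$ is an eigenvalue of $-\mathcal L|_{\mathscr P_k}$ but not of $-\mathcal L|_{\mathscr P_{k-1}}$, then $$\gamma(\mathcal L)\,\mathrm{gap}_{\rm RW}(\mathcal L)\le \mathrm{Re}(\lambda).$$ No reversibility is assumed. -/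

import Mathlib

open MeasureTheory
open scoped unitInterval

noncomputable section

namespace StochasticExchange

variable {V : Type*} [Fintype V] [DecidableEq V]

/-! ### Configurations, updates and the generator -/

/-- The row vector `η R_{xy}^{uv}`: the coordinates `(η_x, η_y)` are replaced by
`(u η_x + (1 - v) η_y, (1 - u) η_x + v η_y)` and all others are unchanged
(nothing happens if `x = y`). -/
def exchangeVec (x y : V) (u v : I) (η : V → ℝ) : V → ℝ :=
  if x = y then η
  else fun z =>
    if z = x then (u : ℝ) * η x + (1 - v) * η y
    else if z = y then (1 - u) * η x + v * η y
    else η z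

theorem exchangeVec_mem (x y : V) (u v : I) {η : V → ℝ} (hη : η ∈ stdSimplex ℝ V) :
    exchangeVec x y u v η ∈ stdSimplex ℝ V := by
  unfold exchangeVec
  split_ifs with hxy
  · exact hη
  obtain ⟨h0, h1⟩ := hη
  have hu0 := u.2.1
  have hu1 : (0 : ℝ) ≤ 1 - u := sub_nonneg.2 u.2.2
  have hv0 := v.2.1
  have hv1 : (0 : ℝ) ≤ 1 - v := sub_nonneg.2 v.2.2
  have hx := h0 x
  have hy := h0 y
  refine ⟨fun z => ?_, ?_⟩
  · dsimp only
    split_ifs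
    · positivity
    · positivity
    · exact h0 z
  · have key : ∀ z, (if z = x then (u : ℝ) * η x + (1 - v) * η y
        else if z = y then (1 - u) * η x + v * η y else η z)
        = η z + ((if z = x then (1 - (v : ℝ)) * η y - (1 - u) * η x else 0)
          - (if z = y then (1 - (v : ℝ)) * η y - (1 - u) * η x else 0)) := by
      intro z
      by_cases hzx : z = x
      · subst hzx
        simp [hxy]
        ring
      · by_cases hzy : z = y
        · subst hzy
          simp [hzx]
          ring
        · simp [hzx, hzy]
    rw [Finset.sum_congr rfl fun z _ => key z, Finset.sum_add_distrib, Finset.sum_sub_distrib]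
    simp [h1]

/-- The update `η ↦ η R_{xy}^{uv}` as a map of the probability simplex `Ω`. -/
def exchange (x y : V) (u v : I) (η : stdSimplex ℝ V) : stdSimplex ℝ V :=
  ⟨exchangeVec x y u v η, exchangeVec_mem x y u v η.2⟩

/-- The generator
`𝓛 f(η) = ∑_{x,y} ∫ β_{xy}(du,dv) (f(η R_{xy}^{uv}) - f(η))` of the stochastic exchange model. -/
def generator (β : V → V → Measure (I × I)) (f : stdSimplex ℝ V → ℂ) (η : stdSimplex ℝ V) : ℂ :=
  ∑ x, ∑ y, ∫ p, (f (exchange x y p.1 p.2 η) - f η) ∂(β x y)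

/-- `𝒫_k`: complex functions on the simplex given by a polynomial of degree at most `k`. -/
def polyFun (V : Type*) [Fintype V] (k : ℕ) : Set (stdSimplex ℝ V → ℂ) :=
  {f | ∃ p : MvPolynomial V ℂ, p.totalDegree ≤ k ∧
    ∀ η : stdSimplex ℝ V, f η = MvPolynomial.eval (fun x => ((η : V → ℝ) x : ℂ)) p}

/-- `z` is an eigenvalue of `-𝓛` restricted to `𝒫_k`. -/
def IsEigenvalueNegGenerator (β : V → V → Measure (I × I)) (k : ℕ) (z : ℂ) : Prop :=
  ∃ f ∈ polyFun V k, f ≠ 0 ∧ ∀ η, -generator β f η = z * f η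

/-! ### Rates of the associated random walk and the two assumptions -/

/-- The measure `β_{xy}(du,dv) + β_{yx}(dv,du)` in the variables `(u,v)`. -/
def symMeasure (β : V → V → Measure (I × I)) (x y : V) : Measure (I × I) :=
  β x y + (β y x).map Prod.swap

/-- The jump rates `r_{xy}`, `x ≠ y`, of the random walk RW. -/
def rate (β : V → V → Measure (I × I)) (x y : V) : ℝ :=
  ∫ p, (1 - (p.1 : ℝ)) ∂(symMeasure β x y)

/-- The second-order rates `s_{xy}`, `x ≠ y`. -/
def rate₂ (β : V → V → Measure (I × I)) (x y : V) : ℝ :=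
  ∫ p, (p.1 : ℝ) * (1 - (p.1 : ℝ)) ∂(symMeasure β x y)

/-- `β_{xx} = 0` and `∫ β_{xy}(du,dv) ((1-u) + (1-v)) < ∞`; the measures may be infinite. -/
def WellDefined (β : V → V → Measure (I × I)) : Prop :=
  (∀ x, β x x = 0) ∧
    ∀ x y, ∫⁻ p, ENNReal.ofReal ((1 - (p.1 : ℝ)) + (1 - (p.2 : ℝ))) ∂(β x y) < ⊤

/-- Any two vertices are joined by a path along which all `s`-rates are positive. -/
def Irreducible (β : V → V → Measure (I × I)) : Prop :=
  ∀ x y, Relation.TransGen (fun a b => a ≠ b ∧ 0 < rate₂ β a b) x y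

/-! ### The invariant measure of the random walk -/

/-- `w` is an invariant probability measure of the random walk on `V` with jump rates `r`. -/
def IsInvariantProb (r : V → V → ℝ) (w : V → ℝ) : Prop :=
  w ∈ stdSimplex ℝ V ∧
    ∀ x, ∑ y ∈ Finset.univ.erase x, w y * r y x = w x * ∑ y ∈ Finset.univ.erase x, r x y

theorem balance_iff (r : V → V → ℝ) (w : V → ℝ) (x : V) :
    (∑ y ∈ Finset.univ.erase x, w y * r y x = w x * ∑ y ∈ Finset.univ.erase x, r x y) ↔
      ∑ y, w y * r y x = w x * ∑ y, r x y := by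
  rw [← Finset.add_sum_erase _ (fun y => w y * r y x) (Finset.mem_univ x),
    ← Finset.add_sum_erase _ (fun y => r x y) (Finset.mem_univ x), mul_add]
  exact (add_right_inj _).symm

theorem balance_abs {W : Type*} [Fintype W] {r : W → W → ℝ} (hr : ∀ x y, 0 ≤ r x y) {w : W → ℝ}
    (hw : ∀ x, ∑ y, w y * r y x = w x * ∑ y, r x y) (x : W) :
    ∑ y, |w y| * r y x = |w x| * ∑ y, r x y := by
  have hle : ∀ x ∈ Finset.univ, |w x| * ∑ y, r x y ≤ ∑ y, |w y| * r y x := by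
    intro x _
    have h0 : 0 ≤ ∑ y, r x y := Finset.sum_nonneg fun y _ => hr x y
    rw [← abs_of_nonneg h0, ← abs_mul, ← hw x]
    refine (Finset.abs_sum_le_sum_abs _ _).trans_eq ?_
    exact Finset.sum_congr rfl fun y _ => by rw [abs_mul, abs_of_nonneg (hr y x)]
  have hsum : ∑ x, |w x| * ∑ y, r x y = ∑ x, ∑ y, |w y| * r y x := by
    rw [Finset.sum_comm]
    exact Finset.sum_congr rfl fun y _ => Finset.mul_sum _ _ _
  exact ((Finset.sum_eq_sum_iff_of_le hle).1 hsum x (Finset.mem_univ x)).symm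

theorem exists_isInvariantProb [Nonempty V] {r : V → V → ℝ} (hr : ∀ x y, 0 ≤ r x y) :
    ∃ w, IsInvariantProb r w := by
  let Q : Matrix V V ℝ := fun x y => r x y - if x = y then ∑ z, r x z else 0
  have hQ : ∃ v : V → ℝ, v ≠ 0 ∧ Matrix.mulVec Q v = 0 := by
    refine ⟨fun _ => 1, fun h => ?_, ?_⟩
    · exact one_ne_zero (congrFun h (Classical.arbitrary V))
    · ext x
      simp [Q, Matrix.mulVec, dotProduct, Finset.sum_sub_distrib]
  obtain ⟨v, hv0, hv⟩ := Matrix.exists_vecMul_eq_zero_iff.2 (Matrix.exists_mulVec_eq_zero_iff.1 hQ)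
  have hbal : ∀ x, ∑ y, v y * r y x = v x * ∑ y, r x y := by
    intro x
    have := congrFun hv x
    simp only [Q, Matrix.vecMul, dotProduct, mul_sub, Finset.sum_sub_distrib, mul_ite, mul_zero,
      Finset.sum_ite_eq', Finset.mem_univ, if_true, Pi.zero_apply] at this
    linarith
  have habs := balance_abs hr hbal
  have hpos : 0 < ∑ x, |v x| := by
    obtain ⟨x, hx⟩ := Function.ne_iff.1 hv0
    exact Finset.sum_pos' (fun _ _ => abs_nonneg _) ⟨x, Finset.mem_univ x, abs_pos.2 hx⟩
  refine ⟨fun x => (∑ z, |v z|)⁻¹ * |v x|, ⟨fun x => by positivity, ?_⟩, fun x => ?_⟩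
  · rw [← Finset.mul_sum, inv_mul_cancel₀ hpos.ne']
  · rw [balance_iff]
    simp only [mul_assoc]
    rw [← Finset.mul_sum, habs x]

theorem rate_nonneg {W : Type*} (β : W → W → Measure (I × I)) (x y : W) : 0 ≤ rate β x y :=
  integral_nonneg fun p => sub_nonneg.2 p.1.2.2

/-- The invariant probability measure `π` of RW; `isInvariantProb_unique` below shows that it
is unique when RW is irreducible. -/
def invMeasure [Nonempty V] (β : V → V → Measure (I × I)) : V → ℝ :=
  Classical.choose (exists_isInvariantProb (rate_nonneg β))

theorem invMeasure_spec [Nonempty V] (β : V → V → Measure (I × I)) :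
    IsInvariantProb (rate β) (invMeasure β) :=
  Classical.choose_spec (exists_isInvariantProb (rate_nonneg β))

/-- A nonnegative solution of the balance equations of an irreducible walk is zero or positive. -/
theorem balance_pos {W : Type*} [Fintype W] {r : W → W → ℝ} (hr : ∀ x y, 0 ≤ r x y)
    (hirr : ∀ x y, Relation.TransGen (fun a b => 0 < r a b) x y) {w : W → ℝ} (h0 : ∀ x, 0 ≤ w x)
    (hw : ∀ x, ∑ y, w y * r y x = w x * ∑ y, r x y) {a : W} (ha : 0 < w a) (x : W) : 0 < w x := by
  have step : ∀ b c, 0 < w b → 0 < r b c → 0 < w c := by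
    intro b c hb hbc
    rcases (h0 c).eq_or_lt with hc | hc
    · have h1 := hw c
      rw [← hc, zero_mul] at h1
      have h2 := (Finset.sum_eq_zero_iff_of_nonneg
        (fun y _ => mul_nonneg (h0 y) (hr y c))).1 h1 b (Finset.mem_univ b)
      exact absurd h2 (mul_pos hb hbc).ne'
    · exact hc
  induction hirr a x with
  | single h => exact step _ _ ha h
  | tail _ h ih => exact step _ _ ih h

/-- An irreducible walk has only one invariant probability measure, so that the choice made in
the definition of `invMeasure` is immaterial. -/
theorem isInvariantProb_unique {r : V → V → ℝ} (hr : ∀ x y, 0 ≤ r x y)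
    (hirr : ∀ x y, Relation.TransGen (fun a b => 0 < r a b) x y) {w w' : V → ℝ}
    (h : IsInvariantProb r w) (h' : IsInvariantProb r w') : w = w' := by
  have hb : ∀ x, ∑ y, (w y - w' y) * r y x = (w x - w' x) * ∑ y, r x y := by
    intro x
    simp only [sub_mul, Finset.sum_sub_distrib]
    rw [(balance_iff r w x).1 (h.2 x), (balance_iff r w' x).1 (h'.2 x)]
  have habs := balance_abs hr hb
  have hsum : ∑ x, (w x - w' x) = 0 := by
    rw [Finset.sum_sub_distrib, h.1.2, h'.1.2, sub_self]
  have hplus : ∀ x, ∑ y, (|w y - w' y| + (w y - w' y)) * r y x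
      = (|w x - w' x| + (w x - w' x)) * ∑ y, r x y := by
    intro x
    simp only [add_mul, Finset.sum_add_distrib]
    rw [hb x, habs x]
  have hle : ∀ x, w x - w' x ≤ 0 := by
    by_contra! hcon
    obtain ⟨a, ha⟩ := hcon
    have hall : ∀ x, 0 < w x - w' x := by
      intro x
      have := balance_pos hr hirr (fun x => by linarith [neg_abs_le (w x - w' x)]) hplus
        (a := a) (by positivity) x
      by_contra! hx
      rw [abs_of_nonpos hx] at this
      linarith
    exact (Finset.sum_pos (fun x _ => hall x) ⟨a, Finset.mem_univ a⟩).ne' hsum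
  ext x
  exact sub_eq_zero.1 ((Finset.sum_eq_zero_iff_of_nonpos fun x _ => hle x).1 hsum x
    (Finset.mem_univ x))

/-! ### Spectral gap of the random walk and the constant `γ(𝓛)` -/

/-- The symmetrised edge weights `π_{xy} = (π_x r_{xy} + π_y r_{yx}) / 2`. -/
def edgeWeight [Nonempty V] (β : V → V → Measure (I × I)) (x y : V) : ℝ :=
  (invMeasure β x * rate β x y + invMeasure β y * rate β y x) / 2

/-- The Dirichlet form of RW. -/
def dirichletRW [Nonempty V] (β : V → V → Measure (I × I)) (ψ : V → ℝ) : ℝ :=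
  1 / 2 * ∑ x, ∑ y, edgeWeight β x y * (ψ y - ψ x) ^ 2

/-- The norm `‖ψ - πψ‖` in `L²(π)`. -/
def centredNorm [Nonempty V] (β : V → V → Measure (I × I)) (ψ : V → ℝ) : ℝ :=
  √(∑ x, invMeasure β x * (ψ x - ∑ z, invMeasure β z * ψ z) ^ 2)

/-- The spectral gap of RW. -/
def gapRW [Nonempty V] (β : V → V → Measure (I × I)) : ℝ :=
  sInf {e | ∃ ψ : V → ℝ, centredNorm β ψ = 1 ∧ e = dirichletRW β ψ}

def chi [Nonempty V] (β : V → V → Measure (I × I)) (x y : V) : ℝ :=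
  ∫ p, (invMeasure β x * ((p.1 : ℝ) * (1 - (p.1 : ℝ)))
    + invMeasure β y * ((p.2 : ℝ) * (1 - (p.2 : ℝ)))) ∂(symMeasure β x y)

def sigma [Nonempty V] (β : V → V → Measure (I × I)) (x y : V) : ℝ :=
  ∫ p, (invMeasure β x * (1 - (p.1 : ℝ)) - invMeasure β y * (1 - (p.2 : ℝ))) ^ 2
    ∂(symMeasure β x y)

/-- `γ(𝓛)`: the minimum of `(χ_{xy} + σ_{xy}) / π_{xy}` over the (finitely many) pairs of
distinct vertices with `π_{xy} > 0`. -/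
def gamma [Nonempty V] (β : V → V → Measure (I × I)) : ℝ :=
  sInf {c | ∃ x y : V, x ≠ y ∧ 0 < edgeWeight β x y ∧
    c = (chi β x y + sigma β x y) / edgeWeight β x y}

end StochasticExchange

end

/-!
The proof is a maximum principle for a dual eigenfunction.

An update acts on configurations `η` by a row-stochastic matrix from the right; its transpose `mix`
acts on functions `ψ : V → ℝ`, and `⟨η R, ψ⟩ = ⟨η, mix ψ⟩`. If `lam` is an eigenvalue of `-𝓛` on
`𝒫_k` but not on `𝒫_{k-1}`, then `-𝓛` has on `𝒫_k` a left eigenvector `Λ` for `lam` that vanishes on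
`𝒫_{k-1}`. As `𝒫_k` is finite-dimensional, `Λ` is a finite combination of point evaluations, so it
commutes with the integrals against the (possibly infinite) measures `β_{xy}`. The function
`P ψ = Λ(⟨·, ψ⟩ ^ k)` is then an eigenfunction of the generator of the transposed dynamics, is
homogeneous of degree `k`, and does not change when a constant is added to `ψ`; it is nonzero
because the `k`-th powers of linear forms span `𝒫_k` modulo `𝒫_{k-1}`
(`exists_dual_eigenfunction`).

On the other side, under the transposed dynamics the variance `Var_π ψ` is dissipated exactly at
rate `∑_{{x, y}} (χ_{xy} + σ_{xy}) (ψ_y - ψ_x) ^ 2`: the terms of first order cancel because `π` is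
invariant, and no reversibility is needed (`integral_wvar_mix_sub`). By the definitions of `γ` and
of the gap this is at least `γ * gap * Var_π ψ` (`gamma_mul_gapRW_mul_wvar_le`).

Finally let `C` be the maximum of `|P| / Var_π` over functions with minimum `0` and maximum `1`. As
`k ≥ 2`, homogeneity gives `|P| ≤ C * Var_π` on all of `[0, 1]^V` (`exists_extremal`), a set
preserved by `mix`. At the maximizer, integrating
`|P (mix ψ)| - |P ψ| ≤ C * (Var_π (mix ψ) - Var_π ψ)` turns the two facts above into
`γ * gap ≤ Re lam`.
-/

noncomputable section

namespace StochasticExchange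

/-! ### Finite-dimensional spaces of functions -/

section FiniteDimensional

variable {X : Type*} {E : Submodule ℂ (X → ℂ)}

/-- Point evaluations separate the elements of a space of functions, hence span its dual when the
space is finite-dimensional. -/
theorem exists_dual_eq_sum_eval [FiniteDimensional ℂ E] (Λ : Module.Dual ℂ E) :
    ∃ c : X →₀ ℂ, ∀ f : E, Λ f = c.sum fun x a => a * (f : X → ℂ) x := by
  let ev : X → Module.Dual ℂ E := fun x => (LinearMap.proj x).comp E.subtype
  have hbot : (Submodule.span ℂ (Set.range ev)).dualCoannihilator = ⊥ := by
    rw [eq_bot_iff]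
    intro f hf
    rw [← SetLike.mem_coe, Submodule.coe_dualCoannihilator_span] at hf
    have : (f : X → ℂ) = 0 := funext fun x => hf (ev x) ⟨x, rfl⟩
    simpa using this
  have htop : Submodule.span ℂ (Set.range ev) = ⊤ := by
    rw [← Subspace.dualCoannihilator_dualAnnihilator_eq (W := Submodule.span ℂ (Set.range ev)),
      hbot, Submodule.dualAnnihilator_bot]
  have hΛ : Λ ∈ Submodule.span ℂ (Set.range ev) := htop ▸ Submodule.mem_top
  obtain ⟨c, hc⟩ := Finsupp.mem_span_range_iff_exists_finsupp.1 hΛ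
  refine ⟨c, fun f => ?_⟩
  rw [← hc, Finsupp.sum, LinearMap.sum_apply]
  rfl

/-- A pointwise integral of members of a finite-dimensional space of functions stays in that
space. -/
theorem integral_mem_of_finiteDimensional [FiniteDimensional ℂ E] {Y : Type*} [MeasurableSpace Y]
    {μ : Measure Y} {g : Y → X → ℂ} (hg : ∀ y, g y ∈ E)
    (hint : ∀ x, Integrable (fun y => g y x) μ) : (fun x => ∫ y, g y x ∂μ) ∈ E := by
  let b := Module.finBasis ℂ E
  choose c hc using fun i => exists_dual_eq_sum_eval (b.coord i)
  have hexp : ∀ y x, g y x = ∑ i, ((c i).sum fun x' a => a * g y x') * (b i : X → ℂ) x := by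
    intro y x
    have h := congrArg (fun f : E => (f : X → ℂ) x) (b.sum_repr ⟨g y, hg y⟩)
    simp only [Submodule.coe_sum, Submodule.coe_smul, Finset.sum_apply, Pi.smul_apply,
      smul_eq_mul] at h
    rw [← h]
    refine Finset.sum_congr rfl fun i _ => ?_
    rw [← hc i ⟨g y, hg y⟩, b.coord_apply]
  have hI : (fun x => ∫ y, g y x ∂μ)
      = ∑ i, ((c i).sum fun x' a => a * ∫ y, g y x' ∂μ) • (b i : X → ℂ) := by
    ext x
    have hi : ∀ i, Integrable (fun y => (c i).sum fun x' a => a * g y x') μ := fun i =>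
      integrable_finsetSum _ fun x' _ => (hint x').const_mul _
    simp only [hexp _ x, Finset.sum_apply, Pi.smul_apply, smul_eq_mul]
    rw [integral_finsetSum _ fun i _ => (hi i).mul_const _]
    refine Finset.sum_congr rfl fun i _ => ?_
    rw [integral_mul_const]
    congr 1
    simp only [Finsupp.sum]
    rw [integral_finsetSum _ fun x' _ => (hint x').const_mul _]
    exact Finset.sum_congr rfl fun x' _ => integral_const_mul _ _
  rw [hI]
  exact E.sum_mem fun i _ => E.smul_mem _ (b i).2

/-- If `z` is an eigenvalue of `T` but not of the restriction of `T` to an invariant subspace `F`,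
then `T` has a left eigenvector for `z` that vanishes on `F`: the restriction of `T - z` to `F` is
onto `F`, so a functional that kills the range of `T - z` kills `F`. -/
theorem exists_left_eigenvector {W : Type*} [AddCommGroup W] [Module ℂ W] [FiniteDimensional ℂ W]
    (T : W →ₗ[ℂ] W) (F : Submodule ℂ W) (hF : ∀ f ∈ F, T f ∈ F) {z : ℂ}
    (hz : ∃ f, f ≠ 0 ∧ T f = z • f) (hzF : ∀ f ∈ F, T f = z • f → f = 0) :
    ∃ Λ : Module.Dual ℂ W, Λ ≠ 0 ∧ (∀ f, Λ (T f) = z * Λ f) ∧ ∀ f ∈ F, Λ f = 0 := by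
  let S : W →ₗ[ℂ] W := T - z • LinearMap.id
  have hS : ∀ f, S f = T f - z • f := fun f => rfl
  have hlt : LinearMap.range S < ⊤ := by
    rw [lt_top_iff_ne_top]
    intro htop
    obtain ⟨f, hf0, hf⟩ := hz
    have hinj := LinearMap.injective_iff_surjective.2 (LinearMap.range_eq_top.1 htop)
    exact hf0 (hinj (by rw [hS, hf, sub_self, map_zero]))
  obtain ⟨Λ, hΛ0, hΛ⟩ := Submodule.exists_le_ker_of_lt_top _ hlt
  have hker : ∀ f, Λ (S f) = 0 := fun f => hΛ (LinearMap.mem_range_self S f)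
  refine ⟨Λ, hΛ0, fun f => ?_, fun f hf => ?_⟩
  · have := hker f
    rw [hS, map_sub, map_smul, smul_eq_mul, sub_eq_zero] at this
    exact this
  · have hSF : ∀ g ∈ F, S g ∈ F := fun g hg => F.sub_mem (hF g hg) (F.smul_mem _ hg)
    have hinj : Function.Injective (S.restrict hSF) := by
      rw [injective_iff_map_eq_zero]
      intro g hg
      have h1 : S g = 0 := congrArg Subtype.val hg
      rw [hS, sub_eq_zero] at h1
      exact Subtype.ext (hzF g g.2 h1)
    obtain ⟨g, hg⟩ := LinearMap.injective_iff_surjective.1 hinj ⟨f, hf⟩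
    have : S g = f := congrArg Subtype.val hg
    rw [← this, hker]

end FiniteDimensional

variable {V : Type*} [Fintype V]

/-! ### The generator on polynomials -/

/-- The function on the simplex given by a complex polynomial. -/
def evalOn (V : Type*) [Fintype V] : MvPolynomial V ℂ →ₗ[ℂ] (stdSimplex ℝ V → ℂ) :=
  LinearMap.pi fun η => (MvPolynomial.aeval fun x => ((η : V → ℝ) x : ℂ)).toLinearMap

theorem evalOn_apply (p : MvPolynomial V ℂ) (η : stdSimplex ℝ V) :
    evalOn V p η = MvPolynomial.eval (fun x => ((η : V → ℝ) x : ℂ)) p := by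
  simp [evalOn, MvPolynomial.aeval_eq_eval]

/-- `polyFun V k` as a linear subspace. -/
def polySub (V : Type*) [Fintype V] (k : ℕ) : Submodule ℂ (stdSimplex ℝ V → ℂ) :=
  (MvPolynomial.restrictTotalDegree V ℂ k).map (evalOn V)

theorem mem_polySub {k : ℕ} {f : stdSimplex ℝ V → ℂ} : f ∈ polySub V k ↔ f ∈ polyFun V k := by
  simp only [polySub, Submodule.mem_map, MvPolynomial.mem_restrictTotalDegree, polyFun,
    Set.mem_ofPred_eq]
  refine exists_congr fun p => and_congr_right fun _ => ?_
  rw [funext_iff]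
  exact forall_congr' fun η => by rw [evalOn_apply, eq_comm]

instance (k : ℕ) : FiniteDimensional ℂ (polySub V k) := by
  unfold polySub
  infer_instance

theorem polySub_mono {j k : ℕ} (h : j ≤ k) : polySub V j ≤ polySub V k := by
  refine Submodule.map_mono fun p hp => ?_
  rw [MvPolynomial.mem_restrictTotalDegree] at hp ⊢
  exact hp.trans h

theorem evalOn_mem {k : ℕ} {p : MvPolynomial V ℂ} (hp : p.totalDegree ≤ k) :
    evalOn V p ∈ polySub V k :=
  Submodule.mem_map_of_mem ((MvPolynomial.mem_restrictTotalDegree _ _ _).2 hp)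

theorem exchange_apply [DecidableEq V] (x y : V) (u v : I) (η : stdSimplex ℝ V) (z : V) :
    ((exchange x y u v η : stdSimplex ℝ V) : V → ℝ) z = if x = y then (η : V → ℝ) z
      else if z = x then (u : ℝ) * (η : V → ℝ) x + (1 - v) * (η : V → ℝ) y
      else if z = y then (1 - u) * (η : V → ℝ) x + v * (η : V → ℝ) y else (η : V → ℝ) z := by
  change exchangeVec x y u v η z = _
  by_cases hxy : x = y
  · simp [exchangeVec, hxy]
  · simp [exchangeVec, hxy]

/-- The coordinates of `η R_{xy}^{uv}` as linear forms in `η`. -/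
def exchangePoly {V : Type*} [DecidableEq V] (x y : V) (u v : I) (z : V) : MvPolynomial V ℂ :=
  if x = y then .X z
  else if z = x then .C ((u : ℝ) : ℂ) * .X x + .C (((1 - v : ℝ)) : ℂ) * .X y
  else if z = y then .C ((1 - u : ℝ) : ℂ) * .X x + .C ((v : ℝ) : ℂ) * .X y
  else .X z

theorem totalDegree_exchangePoly_le {V : Type*} [DecidableEq V] (x y : V) (u v : I) (z : V) :
    (exchangePoly x y u v z).totalDegree ≤ 1 := by
  have hX : ∀ w : V, (MvPolynomial.X w : MvPolynomial V ℂ).totalDegree ≤ 1 := fun w =>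
    (MvPolynomial.totalDegree_X w).le
  have hC : ∀ (a b : ℂ) (w w' : V), (MvPolynomial.C a * MvPolynomial.X w
      + MvPolynomial.C b * MvPolynomial.X w' : MvPolynomial V ℂ).totalDegree ≤ 1 := by
    intro a b w w'
    refine (MvPolynomial.totalDegree_add _ _).trans (max_le ?_ ?_) <;>
    · refine (MvPolynomial.totalDegree_mul _ _).trans ?_
      rw [MvPolynomial.totalDegree_C, zero_add]
      exact hX _
  unfold exchangePoly
  split_ifs
  exacts [hX _, hC _ _ _ _, hC _ _ _ _, hX _]

theorem eval_exchangePoly [DecidableEq V] (x y : V) (u v : I) (η : stdSimplex ℝ V) (z : V) :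
    MvPolynomial.eval (fun w => ((η : V → ℝ) w : ℂ)) (exchangePoly x y u v z)
      = (((exchange x y u v η : stdSimplex ℝ V) : V → ℝ) z : ℂ) := by
  rw [exchange_apply]
  unfold exchangePoly
  split_ifs <;> simp

theorem comp_exchange_mem [DecidableEq V] (x y : V) (u v : I) {k : ℕ} {f : stdSimplex ℝ V → ℂ}
    (hf : f ∈ polySub V k) : (fun η => f (exchange x y u v η)) ∈ polySub V k := by
  obtain ⟨p, hp, rfl⟩ := hf
  rw [SetLike.mem_coe, MvPolynomial.mem_restrictTotalDegree] at hp
  have hdeg : (MvPolynomial.bind₁ (exchangePoly x y u v) p).totalDegree ≤ k := by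
    rw [MvPolynomial.bind₁, MvPolynomial.aeval_def, MvPolynomial.eval₂_eq]
    refine MvPolynomial.totalDegree_finsetSum_le fun m hm => ?_
    refine (MvPolynomial.totalDegree_mul _ _).trans ?_
    rw [MvPolynomial.algebraMap_eq, MvPolynomial.totalDegree_C, zero_add]
    refine (MvPolynomial.totalDegree_finsetProd _ _).trans ?_
    refine le_trans (Finset.sum_le_sum fun i _ => (MvPolynomial.totalDegree_pow _ _).trans
      (Nat.mul_le_mul_left _ (totalDegree_exchangePoly_le x y u v i))) ?_
    simp only [mul_one]
    exact (MvPolynomial.le_totalDegree hm).trans hp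
  convert evalOn_mem hdeg using 1
  ext η
  rw [evalOn_apply, evalOn_apply]
  simp only [← eval_exchangePoly]
  rw [← MvPolynomial.coe_aeval_eq_eval, ← MvPolynomial.coe_aeval_eq_eval]
  exact (MvPolynomial.aeval_bind₁ _ _ _).symm

theorem integrable_one_sub {V : Type*} {β : V → V → Measure (I × I)} (hβ : WellDefined β)
    (x y : V) : Integrable (fun p : I × I => 1 - (p.1 : ℝ)) (β x y) ∧
      Integrable (fun p : I × I => 1 - (p.2 : ℝ)) (β x y) := by
  have h0 : ∀ p : I × I, 0 ≤ 1 - (p.1 : ℝ) ∧ 0 ≤ 1 - (p.2 : ℝ) := fun p =>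
    ⟨sub_nonneg.2 p.1.2.2, sub_nonneg.2 p.2.2.2⟩
  have hsum : Integrable (fun p : I × I => (1 - (p.1 : ℝ)) + (1 - (p.2 : ℝ))) (β x y) := by
    refine ⟨by fun_prop, ?_⟩
    rw [hasFiniteIntegral_iff_ofReal (.of_forall fun p => add_nonneg (h0 p).1 (h0 p).2)]
    exact hβ.2 x y
  constructor
  · refine hsum.mono (by fun_prop) (.of_forall fun p => ?_)
    rw [Real.norm_of_nonneg (h0 p).1, Real.norm_of_nonneg (add_nonneg (h0 p).1 (h0 p).2)]
    linarith [(h0 p).2]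
  · refine hsum.mono (by fun_prop) (.of_forall fun p => ?_)
    rw [Real.norm_of_nonneg (h0 p).2, Real.norm_of_nonneg (add_nonneg (h0 p).1 (h0 p).2)]
    linarith [(h0 p).1]

theorem _root_.Continuous.mul_integrable {Y A : Type*} [TopologicalSpace Y] [CompactSpace Y]
    [MeasurableSpace Y] [OpensMeasurableSpace Y] [NormedRing A] [SecondCountableTopology A]
    {μ : Measure Y} {h g : Y → A} (hh : Continuous h)
    (hg : Integrable g μ) : Integrable (fun y => h y * g y) μ := by
  obtain ⟨C, hC⟩ := isCompact_univ.exists_bound_of_continuousOn hh.continuousOn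
  exact hg.bdd_mul hh.aestronglyMeasurable (.of_forall fun y => hC y (Set.mem_univ y))

theorem continuous_exchange_apply [DecidableEq V] (x y z : V) (η : stdSimplex ℝ V) :
    Continuous fun p : I × I => ((exchange x y p.1 p.2 η : stdSimplex ℝ V) : V → ℝ) z := by
  simp only [exchange_apply]
  split_ifs <;> fun_prop

/-- Increments of polynomials are integrable although `β x y` may be infinite: those of a coordinate
are combinations of `1 - u` and `1 - v`, and a product telescopes into bounded multiples of
increments of its factors. -/
theorem integrable_exchange_sub [DecidableEq V] {β : V → V → Measure (I × I)}
    (hβ : WellDefined β) {k : ℕ} {f : stdSimplex ℝ V → ℂ} (hf : f ∈ polySub V k)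
    (x y : V) (η : stdSimplex ℝ V) :
    Integrable (fun p : I × I => f (exchange x y p.1 p.2 η) - f η) (β x y) := by
  obtain ⟨p, -, rfl⟩ := hf
  have hcont : ∀ p : MvPolynomial V ℂ,
      Continuous fun q : I × I => evalOn V p (exchange x y q.1 q.2 η) := by
    intro p
    simp only [evalOn_apply, MvPolynomial.eval_eq']
    refine continuous_finsetSum _ fun m _ => continuous_const.mul
      (continuous_finsetProd _ fun i _ => .pow ?_ _)
    exact Complex.continuous_ofReal.comp (continuous_exchange_apply x y i η)
  induction p using MvPolynomial.induction_on with
  | C a => simp [evalOn_apply]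
  | add p q hp hq =>
    refine (hp.add hq).congr (.of_forall fun r => ?_)
    simp only [Pi.add_apply, map_add]
    ring
  | mul_X p z hp =>
    have hz : Integrable (fun q : I × I =>
        ((exchange x y q.1 q.2 η : stdSimplex ℝ V) : V → ℝ) z - (η : V → ℝ) z) (β x y) := by
      obtain ⟨h1, h2⟩ := integrable_one_sub hβ x y
      have h3 := (h1.mul_const ((η : V → ℝ) x)).sub (h2.mul_const ((η : V → ℝ) y))
      simp only [exchange_apply]
      split_ifs with hxy hzx hzy
      · simp
      · refine h3.neg.congr (.of_forall fun q => ?_)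
        simp only [Pi.neg_apply, Pi.sub_apply, hzx]
        ring
      · refine h3.congr (.of_forall fun q => ?_)
        simp only [Pi.sub_apply, hzy]
        ring
      · simp
    have hzc : Integrable (fun q : I × I => ((((exchange x y q.1 q.2 η : stdSimplex ℝ V) : V → ℝ) z
        - (η : V → ℝ) z : ℝ) : ℂ)) (β x y) := hz.ofReal
    refine (((hcont p).mul_integrable hzc).add (hp.mul_const ((η : V → ℝ) z : ℂ))).congr
      (.of_forall fun q => ?_)
    simp only [Pi.add_apply, evalOn_apply, map_mul, MvPolynomial.eval_X, Complex.ofReal_sub]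
    ring

theorem generator_mem [DecidableEq V] {β : V → V → Measure (I × I)} (hβ : WellDefined β) {k : ℕ}
    {f : stdSimplex ℝ V → ℂ} (hf : f ∈ polySub V k) : generator β f ∈ polySub V k := by
  have : generator β f
      = ∑ x, ∑ y, fun η => ∫ p, (f (exchange x y p.1 p.2 η) - f η) ∂(β x y) := by
    ext η
    simp [generator]
  rw [this]
  refine Submodule.sum_mem _ fun x _ => Submodule.sum_mem _ fun y _ => ?_
  have hmem : ∀ p : I × I, (fun η => f (exchange x y p.1 p.2 η) - f η) ∈ polySub V k := fun p =>
    Submodule.sub_mem _ (comp_exchange_mem x y p.1 p.2 hf) hf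
  exact integral_mem_of_finiteDimensional hmem fun η => integrable_exchange_sub hβ hf x y η

/-- The operator `-𝓛` on polynomials of degree at most `k`. -/
def negGenerator [DecidableEq V] {β : V → V → Measure (I × I)} (hβ : WellDefined β) (k : ℕ) :
    polySub V k →ₗ[ℂ] polySub V k where
  toFun f := -⟨generator β f, generator_mem hβ f.2⟩
  map_add' f g := by
    rw [← neg_add]
    refine congrArg Neg.neg (Subtype.ext (funext fun η => ?_))
    simp only [generator, Submodule.coe_add, Pi.add_apply]
    simp only [← Finset.sum_add_distrib]
    refine Finset.sum_congr rfl fun x _ => Finset.sum_congr rfl fun y _ => ?_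
    rw [← integral_add (integrable_exchange_sub hβ f.2 x y η)
      (integrable_exchange_sub hβ g.2 x y η)]
    congr 1
    ext p
    ring
  map_smul' a f := by
    rw [RingHom.id_apply, smul_neg]
    refine congrArg Neg.neg (Subtype.ext (funext fun η => ?_))
    simp only [generator, Submodule.coe_smul, Pi.smul_apply, smul_eq_mul, Finset.mul_sum,
      ← mul_sub, integral_const_mul]

theorem negGenerator_apply [DecidableEq V] {β : V → V → Measure (I × I)}
    (hβ : WellDefined β) {k : ℕ} (f : polySub V k) (η : stdSimplex ℝ V) :
    (negGenerator hβ k f : stdSimplex ℝ V → ℂ) η = -generator β f η := rfl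

/-! ### The dual eigenfunction -/

/-- The transpose of the update `η ↦ η R_{xy}^{uv}`, acting on functions `ψ` on `V`: the value at
`x` becomes `u ψ_x + (1 - u) ψ_y`, the value at `y` becomes `(1 - v) ψ_x + v ψ_y`. -/
def mix {V : Type*} [DecidableEq V] (x y : V) (u v : I) (ψ : V → ℝ) : V → ℝ := fun z =>
  ψ z + (if z = x then (1 - (u : ℝ)) * (ψ y - ψ x) else 0)
    + (if z = y then (1 - (v : ℝ)) * (ψ x - ψ y) else 0)

/-- The pairing `⟨η, ψ⟩` of a configuration with a function on `V`. -/
def pairing (ψ : V → ℝ) (η : stdSimplex ℝ V) : ℝ := ∑ z, (η : V → ℝ) z * ψ z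

theorem pairing_exchange [DecidableEq V] (x y : V) (u v : I) (ψ : V → ℝ) (η : stdSimplex ℝ V) :
    pairing ψ (exchange x y u v η) = pairing (mix x y u v ψ) η := by
  set a : ℝ := (1 - (v : ℝ)) * (η : V → ℝ) y - (1 - (u : ℝ)) * (η : V → ℝ) x
  have h : ∀ z, ((exchange x y u v η : stdSimplex ℝ V) : V → ℝ) z
      = (η : V → ℝ) z + ((if z = x then a else 0) - if z = y then a else 0) := by
    intro z
    rw [exchange_apply]
    split_ifs <;> subst_vars <;> first | contradiction | ring
  simp only [pairing, h, mix, add_mul, sub_mul, mul_add, Finset.sum_add_distrib,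
    Finset.sum_sub_distrib, ite_mul, mul_ite, zero_mul, mul_zero, Finset.sum_ite_eq',
    Finset.mem_univ, if_true]
  simp only [a]
  ring

theorem pairing_add_const (ψ : V → ℝ) (t : ℝ) (η : stdSimplex ℝ V) :
    pairing (fun z => ψ z + t) η = pairing ψ η + t := by
  have h1 : ∑ z, (η : V → ℝ) z = 1 := η.2.2
  simp only [pairing, mul_add, Finset.sum_add_distrib]
  rw [← Finset.sum_mul, h1, one_mul]

/-- The linear form `⟨·, ψ⟩` as a polynomial. -/
def pairingPoly (ψ : V → ℝ) : MvPolynomial V ℂ :=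
  ∑ z, MvPolynomial.C (ψ z : ℂ) * MvPolynomial.X z

theorem totalDegree_pairingPoly_le (ψ : V → ℝ) : (pairingPoly ψ).totalDegree ≤ 1 := by
  refine MvPolynomial.totalDegree_finsetSum_le fun z _ => ?_
  refine (MvPolynomial.totalDegree_mul _ _).trans ?_
  rw [MvPolynomial.totalDegree_C, zero_add, MvPolynomial.totalDegree_X]

theorem eval_pairingPoly (ψ : V → ℝ) (η : stdSimplex ℝ V) :
    MvPolynomial.eval (fun x => ((η : V → ℝ) x : ℂ)) (pairingPoly ψ) = (pairing ψ η : ℂ) := by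
  simp [pairingPoly, pairing, mul_comm]

theorem pairing_pow_mem (ψ : V → ℝ) (k : ℕ) :
    (fun η => (pairing ψ η : ℂ) ^ k) ∈ polySub V k := by
  have hdeg : (pairingPoly ψ ^ k).totalDegree ≤ k :=
    (MvPolynomial.totalDegree_pow _ _).trans
      ((Nat.mul_le_mul_left _ (totalDegree_pairingPoly_le ψ)).trans (mul_one k).le)
  convert evalOn_mem hdeg using 1
  ext η
  rw [evalOn_apply, map_pow, eval_pairingPoly]

/-- Shifting `ψ` by a constant changes `⟨η, ψ⟩ ^ k` only in degree less than `k`, as `∑ η = 1`. -/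
theorem pairing_add_const_pow_sub_mem (ψ : V → ℝ) (t : ℝ) {k : ℕ} (hk : 1 ≤ k) :
    (fun η => (pairing (fun z => ψ z + t) η : ℂ) ^ k - (pairing ψ η : ℂ) ^ k)
      ∈ polySub V (k - 1) := by
  have : (fun η : stdSimplex ℝ V => (pairing (fun z => ψ z + t) η : ℂ) ^ k - (pairing ψ η : ℂ) ^ k)
      = ∑ m ∈ Finset.range k,
        ((t : ℂ) ^ (k - m) * (k.choose m : ℂ)) • fun η => (pairing ψ η : ℂ) ^ m := by
    ext η
    rw [pairing_add_const, Complex.ofReal_add, add_pow, Finset.sum_range_succ]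
    simp only [Nat.sub_self, pow_zero, mul_one, Nat.choose_self, Nat.cast_one, add_sub_cancel_right,
      Finset.sum_apply, Pi.smul_apply, smul_eq_mul]
    exact Finset.sum_congr rfl fun m _ => by ring
  rw [this]
  refine Submodule.sum_mem _ fun m hm => Submodule.smul_mem _ _ ?_
  rw [Finset.mem_range] at hm
  exact polySub_mono (by omega) (pairing_pow_mem ψ m)

/-- The linear functional `f ↦ ∑ x, c x * f x` on functions. -/
def evalSum {X : Type*} (c : X →₀ ℂ) : (X → ℂ) →ₗ[ℂ] ℂ :=
  ∑ x ∈ c.support, c x • LinearMap.proj x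

theorem evalSum_apply {X : Type*} (c : X →₀ ℂ) (f : X → ℂ) :
    evalSum c f = ∑ x ∈ c.support, c x * f x := by
  simp [evalSum, LinearMap.sum_apply]

/-- A functional that kills the polynomials of degree less than `k` and the `k`-th powers of real
linear forms kills all polynomials of degree at most `k`: its values on the `k`-th powers form a
polynomial in the coefficients of the linear form, whose own coefficients are, up to multinomial
factors, its values on the monomials of degree `k`. -/
theorem evalSum_eq_zero_of_pairing_pow {c : stdSimplex ℝ V →₀ ℂ} {k : ℕ}
    (hlow : ∀ f ∈ polySub V (k - 1), evalSum c f = 0)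
    (hpow : ∀ ψ : V → ℝ, evalSum c (fun η => (pairing ψ η : ℂ) ^ k) = 0)
    {f : stdSimplex ℝ V → ℂ} (hf : f ∈ polySub V k) : evalSum c f = 0 := by
  let Q : MvPolynomial V ℂ := ∑ η ∈ c.support,
    MvPolynomial.C (c η) * (∑ z, ((η : V → ℝ) z : ℂ) • MvPolynomial.X z) ^ k
  have hQ : Q = 0 := by
    refine MvPolynomial.funext_set (fun _ => Set.range ((↑) : ℝ → ℂ))
      (fun _ => Set.infinite_range_of_injective Complex.ofReal_injective) fun w hw => ?_
    choose ψ hψ using fun z => hw z (Set.mem_univ z)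
    rw [map_zero, ← hpow ψ, evalSum_apply, map_sum]
    refine Finset.sum_congr rfl fun η _ => ?_
    rw [map_mul, MvPolynomial.eval_C, map_pow, map_sum]
    simp only [MvPolynomial.smul_eval, MvPolynomial.eval_X, ← hψ, pairing, Complex.ofReal_sum,
      Complex.ofReal_mul]
  have hmon : ∀ m : V →₀ ℕ, (m.sum fun _ e => e) ≤ k →
      evalSum c (evalOn V (MvPolynomial.monomial m 1)) = 0 := by
    intro m hm
    rcases hm.lt_or_eq with hlt | heq
    · refine hlow _ (evalOn_mem ?_)
      rw [MvPolynomial.totalDegree_monomial _ one_ne_zero]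
      exact Nat.le_sub_one_of_lt hlt
    · have h := congrArg (MvPolynomial.coeff m) hQ
      simp only [Q, MvPolynomial.coeff_sum, MvPolynomial.coeff_C_mul, MvPolynomial.coeff_zero,
        MvPolynomial.coeff_linearCombination_X_pow_of_fintype, if_pos heq] at h
      simp only [mul_left_comm _ (m.multinomial : ℂ)] at h
      rw [← Finset.mul_sum] at h
      have hne : (m.multinomial : ℂ) ≠ 0 := by
        rw [Finsupp.multinomial_eq]
        exact_mod_cast (Nat.multinomial_pos _ _).ne'
      have h' := (mul_eq_zero.1 h).resolve_left hne
      rw [evalSum_apply, ← h']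
      refine Finset.sum_congr rfl fun η _ => ?_
      rw [evalOn_apply, MvPolynomial.eval_monomial, one_mul]
  obtain ⟨p, hp, rfl⟩ := hf
  rw [SetLike.mem_coe, MvPolynomial.mem_restrictTotalDegree] at hp
  rw [p.as_sum, map_sum, map_sum]
  refine Finset.sum_eq_zero fun m hm => ?_
  rw [← mul_one (MvPolynomial.coeff m p), ← smul_eq_mul, ← MvPolynomial.smul_monomial, map_smul,
    map_smul, hmon m ((MvPolynomial.le_totalDegree hm).trans hp), smul_zero]

/-- An eigenvalue `lam` of `-𝓛` that is new in degree `k` has a dual eigenfunction: a nonzero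
homogeneous function `P` of degree `k` on `ℝ^V`, invariant under the addition of constants, for
which the generator of the transposed dynamics gives `-lam * P`. It is `ψ ↦ Λ(⟨·, ψ⟩ ^ k)` for a
left eigenvector `Λ` that vanishes on polynomials of lower degree. -/
theorem exists_dual_eigenfunction [DecidableEq V] {β : V → V → Measure (I × I)}
    (hβ : WellDefined β) {k : ℕ} (hk : 1 ≤ k) {lam : ℂ}
    (hlam : IsEigenvalueNegGenerator β k lam) (hlam' : ¬ IsEigenvalueNegGenerator β (k - 1) lam) :
    ∃ P : (V → ℝ) → ℂ, Continuous P ∧ (∀ (s : ℝ) ψ, P (s • ψ) = (s : ℂ) ^ k * P ψ) ∧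
      (∀ (t : ℝ) ψ, P (fun z => ψ z + t) = P ψ) ∧ (∃ ψ, P ψ ≠ 0) ∧
      (∀ x y ψ, Integrable (fun p : I × I => P (mix x y p.1 p.2 ψ) - P ψ) (β x y)) ∧
      ∀ ψ, ∑ x, ∑ y, ∫ p, (P (mix x y p.1 p.2 ψ) - P ψ) ∂(β x y) = -lam * P ψ := by
  have hle : polySub V (k - 1) ≤ polySub V k := polySub_mono (Nat.sub_le k 1)
  obtain ⟨Λ, hΛ0, hΛ, hΛF⟩ := exists_left_eigenvector (negGenerator hβ k)
    ((polySub V (k - 1)).submoduleOf (polySub V k)) (z := lam)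
    (fun f hf => Submodule.neg_mem (polySub V (k - 1)) (generator_mem hβ hf))
    (by
      obtain ⟨f, hf, hf0, hfe⟩ := hlam
      exact ⟨⟨f, mem_polySub.2 hf⟩, fun h => hf0 (congrArg Subtype.val h),
        Subtype.ext (funext hfe)⟩)
    (by
      intro f hf hfe
      by_contra hf0
      exact hlam' ⟨f, mem_polySub.1 hf, fun h => hf0 (Subtype.ext h),
        fun η => congrFun (congrArg Subtype.val hfe) η⟩)
  obtain ⟨c, hc⟩ := exists_dual_eq_sum_eval Λ
  replace hc : ∀ f : polySub V k, Λ f = evalSum c f := fun f =>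
    (hc f).trans (evalSum_apply c f).symm
  have hlow : ∀ f ∈ polySub V (k - 1), evalSum c f = 0 := fun f hf => by
    rw [← hc ⟨f, hle hf⟩]
    exact hΛF _ hf
  have hint : ∀ x y ψ η, Integrable (fun p : I × I =>
      (pairing (mix x y p.1 p.2 ψ) η : ℂ) ^ k - (pairing ψ η : ℂ) ^ k) (β x y) := by
    intro x y ψ η
    simpa only [pairing_exchange] using
      integrable_exchange_sub hβ (pairing_pow_mem ψ k) x y η
  refine ⟨fun ψ => evalSum c fun η => (pairing ψ η : ℂ) ^ k, ?_, ?_, ?_, ?_, ?_, ?_⟩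
  · simp only [evalSum_apply, pairing]
    fun_prop
  · intro s ψ
    have h : (fun η : stdSimplex ℝ V => (pairing (s • ψ) η : ℂ) ^ k)
        = (s : ℂ) ^ k • fun η => (pairing ψ η : ℂ) ^ k := by
      ext η
      simp only [pairing, Pi.smul_apply, smul_eq_mul]
      rw [← mul_pow, ← Complex.ofReal_mul, Finset.mul_sum]
      simp only [mul_left_comm]
    simp only [h, map_smul, smul_eq_mul]
  · intro t ψ
    rw [← sub_eq_zero, ← map_sub]
    exact hlow _ (pairing_add_const_pow_sub_mem ψ t hk)
  · by_contra! hall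
    refine hΛ0 (LinearMap.ext fun f => ?_)
    rw [hc f, evalSum_eq_zero_of_pairing_pow hlow hall f.2, LinearMap.zero_apply]
  · intro x y ψ
    simp only [evalSum_apply, ← Finset.sum_sub_distrib, ← mul_sub]
    exact integrable_finsetSum _ fun η _ => (hint x y ψ η).const_mul _
  · intro ψ
    have h := hΛ ⟨_, pairing_pow_mem ψ k⟩
    rw [hc, hc] at h
    rw [neg_mul, ← h, ← map_neg, evalSum_apply]
    simp only [Pi.neg_apply, negGenerator_apply, neg_neg, generator, pairing_exchange,
      evalSum_apply, ← Finset.sum_sub_distrib, ← mul_sub]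
    have hsum : ∀ x y, ∫ p : I × I, ∑ η ∈ c.support,
        c η * ((pairing (mix x y p.1 p.2 ψ) η : ℂ) ^ k - (pairing ψ η : ℂ) ^ k) ∂(β x y)
        = ∑ η ∈ c.support, c η * ∫ p : I × I,
          ((pairing (mix x y p.1 p.2 ψ) η : ℂ) ^ k - (pairing ψ η : ℂ) ^ k) ∂(β x y) := by
      intro x y
      rw [integral_finsetSum _ fun η _ => (hint x y ψ η).const_mul _]
      exact Finset.sum_congr rfl fun η _ => integral_const_mul _ _
    simp only [hsum, Finset.mul_sum]
    rw [Finset.sum_comm' (t' := Finset.univ) (s' := fun _ => c.support) (by simp)]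
    exact Finset.sum_congr rfl fun x _ => Finset.sum_comm

/-! ### Dissipation of the variance -/

/-- The variance of `ψ` under the weights `w`. -/
def wvar (w ψ : V → ℝ) : ℝ := ∑ x, w x * (ψ x - ∑ z, w z * ψ z) ^ 2

theorem wvar_nonneg {w : V → ℝ} (hw : ∀ x, 0 ≤ w x) (ψ : V → ℝ) : 0 ≤ wvar w ψ :=
  Finset.sum_nonneg fun x _ => mul_nonneg (hw x) (sq_nonneg _)

theorem wvar_eq {w : V → ℝ} (hw : ∑ x, w x = 1) (ψ : V → ℝ) :
    wvar w ψ = ∑ x, w x * ψ x ^ 2 - (∑ x, w x * ψ x) ^ 2 := by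
  set m := ∑ x, w x * ψ x
  have h : ∀ x, w x * (ψ x - m) ^ 2 = w x * ψ x ^ 2 - 2 * m * (w x * ψ x) + m ^ 2 * w x :=
    fun x => by ring
  change ∑ x, w x * (ψ x - m) ^ 2 = _
  simp only [h, Finset.sum_add_distrib, Finset.sum_sub_distrib, ← Finset.mul_sum, hw]
  rw [show ∑ x, w x * ψ x = m from rfl]
  ring

theorem wvar_smul (w ψ : V → ℝ) (s : ℝ) : wvar w (s • ψ) = s ^ 2 * wvar w ψ := by
  have h : ∑ z, w z * (s • ψ) z = s * ∑ z, w z * ψ z := by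
    rw [Finset.mul_sum]
    exact Finset.sum_congr rfl fun z _ => by simp [mul_left_comm]
  rw [wvar, h, wvar, Finset.mul_sum _ _ (s ^ 2)]
  refine Finset.sum_congr rfl fun x _ => ?_
  simp only [Pi.smul_apply, smul_eq_mul]
  ring

theorem wvar_add_const {w : V → ℝ} (hw : ∑ x, w x = 1) (ψ : V → ℝ) (t : ℝ) :
    wvar w (fun z => ψ z + t) = wvar w ψ := by
  simp only [wvar, mul_add, Finset.sum_add_distrib, ← Finset.sum_mul, hw, one_mul,
    add_sub_add_right_eq_sub]

theorem wvar_pos {w : V → ℝ} (hw : ∀ x, 0 < w x) {ψ : V → ℝ} {x y : V} (h : ψ x ≠ ψ y) :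
    0 < wvar w ψ := by
  refine (wvar_nonneg (fun x => (hw x).le) ψ).lt_of_ne' fun h0 => h ?_
  have h1 := (Finset.sum_eq_zero_iff_of_nonneg
    fun x _ => mul_nonneg (hw x).le (sq_nonneg (ψ x - ∑ z, w z * ψ z))).1 h0
  have h2 : ∀ x, ψ x = ∑ z, w z * ψ z := fun x => by
    have := (mul_eq_zero.1 (h1 x (Finset.mem_univ x))).resolve_left (hw x).ne'
    exact sub_eq_zero.1 (pow_eq_zero_iff two_ne_zero |>.1 this)
  rw [h2 x, h2 y]

/-- The change of the variance under one update of the transposed dynamics. -/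
theorem wvar_mix_sub [DecidableEq V] {w : V → ℝ} (hw : ∑ x, w x = 1) (ψ : V → ℝ) (x y : V)
    (u v : I) :
    wvar w (mix x y u v ψ) - wvar w ψ =
      (2 * (ψ y - ψ x) * (w x * (ψ x - ∑ z, w z * ψ z)) + (ψ y - ψ x) ^ 2 * w x) * (1 - (u : ℝ))
      + (-2 * (ψ y - ψ x) * (w y * (ψ y - ∑ z, w z * ψ z)) + (ψ y - ψ x) ^ 2 * w y)
        * (1 - (v : ℝ))
      - (ψ y - ψ x) ^ 2 * (w x * ((u : ℝ) * (1 - (u : ℝ))) + w y * ((v : ℝ) * (1 - (v : ℝ)))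
        + (w x * (1 - (u : ℝ)) - w y * (1 - (v : ℝ))) ^ 2) := by
  rw [wvar_eq hw, wvar_eq hw]
  set m := ∑ z, w z * ψ z
  by_cases hxy : x = y
  · subst hxy
    have : mix x x u v ψ = ψ := by
      ext z
      simp [mix]
    rw [this]
    simp [m]
  · set a := (1 - (u : ℝ)) * (ψ y - ψ x) with ha
    set b := (1 - (v : ℝ)) * (ψ x - ψ y) with hb
    have h1 : ∑ z, w z * mix x y u v ψ z = m + w x * a + w y * b := by
      simp [mix, mul_add, Finset.sum_add_distrib, m, a, b]
    have hsq : ∀ z, w z * mix x y u v ψ z ^ 2 = w z * ψ z ^ 2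
        + (if z = x then w x * (2 * ψ x * a + a ^ 2) else 0)
        + (if z = y then w y * (2 * ψ y * b + b ^ 2) else 0) := by
      intro z
      unfold mix
      rw [← ha, ← hb]
      split_ifs <;> subst_vars <;> first | contradiction | ring
    simp only [h1, hsq, Finset.sum_add_distrib, Finset.sum_ite_eq', Finset.mem_univ, if_true]
    rw [ha, hb]
    ring

theorem integral_symMeasure {V : Type*} {β : V → V → Measure (I × I)} {x y : V} {g : I × I → ℝ}
    (hg : Measurable g) (h1 : Integrable g (β x y))
    (h2 : Integrable (fun p : I × I => g (p.2, p.1)) (β y x)) :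
    ∫ p, g p ∂(symMeasure β x y) = ∫ p, g p ∂(β x y) + ∫ p, g (p.2, p.1) ∂(β y x) := by
  rw [symMeasure, integral_add_measure h1
    ((integrable_map_measure hg.aestronglyMeasurable measurable_swap.aemeasurable).2 h2),
    integral_map measurable_swap.aemeasurable hg.aestronglyMeasurable]
  rfl

theorem integrable_mul_one_sub_add {V : Type*} {β : V → V → Measure (I × I)} (hβ : WellDefined β)
    (x y : V) {f g : I × I → ℝ} (hf : Continuous f) (hg : Continuous g) :
    Integrable (fun p : I × I => f p * (1 - (p.1 : ℝ)) + g p * (1 - (p.2 : ℝ))) (β x y) :=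
  (hf.mul_integrable (integrable_one_sub hβ x y).1).add
    (hg.mul_integrable (integrable_one_sub hβ x y).2)

theorem rate_eq {V : Type*} {β : V → V → Measure (I × I)} (hβ : WellDefined β) (x y : V) :
    rate β x y = ∫ p, (1 - (p.1 : ℝ)) ∂(β x y) + ∫ p, (1 - (p.2 : ℝ)) ∂(β y x) :=
  integral_symMeasure (by fun_prop) (integrable_one_sub hβ x y).1 (integrable_one_sub hβ y x).2

/-- Comparison of the rates; it makes the random walk irreducible. -/
theorem rate₂_le_rate {V : Type*} {β : V → V → Measure (I × I)} (hβ : WellDefined β) (x y : V) :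
    rate₂ β x y ≤ rate β x y := by
  have hint : Integrable (fun p : I × I => 1 - (p.1 : ℝ)) (symMeasure β x y) :=
    (integrable_one_sub hβ x y).1.add_measure
      ((integrable_map_measure (by fun_prop) measurable_swap.aemeasurable).2
        (integrable_one_sub hβ y x).2)
  have hcont : Continuous fun p : I × I => (p.1 : ℝ) := by fun_prop
  refine integral_mono (hcont.mul_integrable hint) hint fun p => ?_
  exact mul_le_of_le_one_left (sub_nonneg.2 p.1.2.2) p.1.2.2

/-- The part of `χ_{xy} + σ_{xy}` that comes from `β_{xy}`. -/
def halfDissipation (β : V → V → Measure (I × I)) (w : V → ℝ) (x y : V) : ℝ :=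
  ∫ p, (w x * ((p.1 : ℝ) * (1 - (p.1 : ℝ))) + w y * ((p.2 : ℝ) * (1 - (p.2 : ℝ)))
    + (w x * (1 - (p.1 : ℝ)) - w y * (1 - (p.2 : ℝ))) ^ 2) ∂(β x y)

theorem integrable_chi {V : Type*} {β : V → V → Measure (I × I)} (hβ : WellDefined β) (a b : ℝ)
    (x y : V) : Integrable (fun p : I × I =>
      a * ((p.1 : ℝ) * (1 - (p.1 : ℝ))) + b * ((p.2 : ℝ) * (1 - (p.2 : ℝ)))) (β x y) := by
  refine (integrable_mul_one_sub_add hβ x y (f := fun p => a * (p.1 : ℝ))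
    (g := fun p => b * (p.2 : ℝ)) (by fun_prop) (by fun_prop)).congr (.of_forall fun p => ?_)
  simp only
  ring

theorem integrable_sigma {V : Type*} {β : V → V → Measure (I × I)} (hβ : WellDefined β) (a b : ℝ)
    (x y : V) : Integrable (fun p : I × I =>
      (a * (1 - (p.1 : ℝ)) - b * (1 - (p.2 : ℝ))) ^ 2) (β x y) := by
  refine (integrable_mul_one_sub_add hβ x y
    (f := fun p => a * (a * (1 - (p.1 : ℝ)) - b * (1 - (p.2 : ℝ))))
    (g := fun p => -b * (a * (1 - (p.1 : ℝ)) - b * (1 - (p.2 : ℝ))))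
    (by fun_prop) (by fun_prop)).congr (.of_forall fun p => ?_)
  simp only
  ring

theorem chi_add_sigma [DecidableEq V] [Nonempty V] {β : V → V → Measure (I × I)}
    (hβ : WellDefined β) (x y : V) :
    chi β x y + sigma β x y
      = halfDissipation β (invMeasure β) x y + halfDissipation β (invMeasure β) y x := by
  have hχ := fun x y => integrable_chi hβ (invMeasure β x) (invMeasure β y) x y
  have hσ := fun x y => integrable_sigma hβ (invMeasure β x) (invMeasure β y) x y
  have h1 : ∀ p : I × I, invMeasure β y * ((p.1 : ℝ) * (1 - (p.1 : ℝ)))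
      + invMeasure β x * ((p.2 : ℝ) * (1 - (p.2 : ℝ)))
      = invMeasure β x * ((p.2 : ℝ) * (1 - (p.2 : ℝ)))
      + invMeasure β y * ((p.1 : ℝ) * (1 - (p.1 : ℝ))) := fun p => add_comm _ _
  have h2 : ∀ p : I × I,
      (invMeasure β y * (1 - (p.1 : ℝ)) - invMeasure β x * (1 - (p.2 : ℝ))) ^ 2
      = (invMeasure β x * (1 - (p.2 : ℝ)) - invMeasure β y * (1 - (p.1 : ℝ))) ^ 2 := fun p => by
    ring
  have e1 : chi β x y = _ := integral_symMeasure (by fun_prop) (hχ x y)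
    ((hχ y x).congr (.of_forall h1))
  have e2 : sigma β x y = _ := integral_symMeasure (by fun_prop) (hσ x y)
    ((hσ y x).congr (.of_forall h2))
  rw [e1, e2, halfDissipation, halfDissipation, integral_add (hχ x y) (hσ x y),
    integral_add (hχ y x) (hσ y x)]
  simp only [h1, h2]
  ring

/-- Invariance of `w` makes the drift terms cancel: the drift along the jumps of the walk is
`∑ w_x r_{xy} (ψ_y ^ 2 - ψ_x ^ 2) = 0`. -/
theorem sum_drift_eq_zero {r : V → V → ℝ} {w : V → ℝ}
    (hw : ∀ x, ∑ y, w y * r y x = w x * ∑ y, r x y) (φ : V → ℝ) :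
    ∑ x, ∑ y, w x * r x y * (φ y ^ 2 - φ x ^ 2) = 0 := by
  simp only [mul_sub, Finset.sum_sub_distrib]
  rw [Finset.sum_comm]
  simp only [← Finset.sum_mul, hw, ← Finset.mul_sum, sub_self]

/-- The variance under the invariant measure is dissipated at rate
`∑_{{x, y}} (χ_{xy} + σ_{xy}) (ψ_y - ψ_x) ^ 2`. -/
theorem integral_wvar_mix_sub [DecidableEq V] [Nonempty V] {β : V → V → Measure (I × I)}
    (hβ : WellDefined β) (ψ : V → ℝ) :
    (∀ x y, Integrable (fun p : I × I => wvar (invMeasure β) (mix x y p.1 p.2 ψ)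
      - wvar (invMeasure β) ψ) (β x y)) ∧
    ∑ x, ∑ y, ∫ p, (wvar (invMeasure β) (mix x y p.1 p.2 ψ) - wvar (invMeasure β) ψ) ∂(β x y)
      = -(1 / 2 * ∑ x, ∑ y, (chi β x y + sigma β x y) * (ψ y - ψ x) ^ 2) := by
  obtain ⟨⟨h0, h1⟩, hbal⟩ := invMeasure_spec β
  replace hbal := fun x => (balance_iff _ _ x).1 (hbal x)
  set w := invMeasure β with hwdef
  set m := ∑ z, w z * ψ z with hm
  let A : V → V → ℝ := fun x y => ∫ p, (1 - (p.1 : ℝ)) ∂(β x y)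
  let B : V → V → ℝ := fun x y => ∫ p, (1 - (p.2 : ℝ)) ∂(β x y)
  let cA : V → V → ℝ := fun x y => 2 * (ψ y - ψ x) * (w x * (ψ x - m)) + (ψ y - ψ x) ^ 2 * w x
  -- The coefficient of `1 - v` is the coefficient of `1 - u` with `x` and `y` exchanged.
  have hcA : ∀ x y, 2 * (ψ y - ψ x) * (w x * (ψ x - m)) + (ψ y - ψ x) ^ 2 * w x = cA x y :=
    fun _ _ => rfl
  have hcB : ∀ x y, -2 * (ψ y - ψ x) * (w y * (ψ y - m)) + (ψ y - ψ x) ^ 2 * w y = cA y x :=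
    fun x y => by
      simp only [cA]
      ring
  have hlin : ∀ x y, Integrable (fun p : I × I =>
      cA x y * (1 - (p.1 : ℝ)) + cA y x * (1 - (p.2 : ℝ))) (β x y) := fun x y =>
    integrable_mul_one_sub_add hβ x y continuous_const continuous_const
  have hquad : ∀ x y, Integrable (fun p : I × I =>
      w x * ((p.1 : ℝ) * (1 - (p.1 : ℝ))) + w y * ((p.2 : ℝ) * (1 - (p.2 : ℝ)))
        + (w x * (1 - (p.1 : ℝ)) - w y * (1 - (p.2 : ℝ))) ^ 2) (β x y) := fun x y =>
    (integrable_chi hβ (w x) (w y) x y).add (integrable_sigma hβ (w x) (w y) x y)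
  have hmix := fun x y u v => wvar_mix_sub h1 ψ x y u v
  simp only [← hm, hcA, hcB] at hmix
  simp only [hmix]
  refine ⟨fun x y => (hlin x y).sub ((hquad x y).const_mul _), ?_⟩
  have hI : ∀ x y, ∫ p : I × I, (cA x y * (1 - (p.1 : ℝ)) + cA y x * (1 - (p.2 : ℝ))
      - (ψ y - ψ x) ^ 2 * (w x * ((p.1 : ℝ) * (1 - (p.1 : ℝ)))
        + w y * ((p.2 : ℝ) * (1 - (p.2 : ℝ)))
        + (w x * (1 - (p.1 : ℝ)) - w y * (1 - (p.2 : ℝ))) ^ 2)) ∂(β x y)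
      = cA x y * A x y + cA y x * B x y - halfDissipation β w x y * (ψ y - ψ x) ^ 2 := by
    intro x y
    rw [integral_sub (hlin x y) ((hquad x y).const_mul _),
      integral_add ((integrable_one_sub hβ x y).1.const_mul _)
        ((integrable_one_sub hβ x y).2.const_mul _),
      integral_const_mul, integral_const_mul, integral_const_mul,
      mul_comm (halfDissipation _ _ _ _)]
    rfl
  have hdrift : ∑ x, ∑ y, (cA x y * A x y + cA y x * B x y) = 0 := by
    rw [← sum_drift_eq_zero hbal fun z => ψ z - m]
    simp only [Finset.sum_add_distrib]
    rw [Finset.sum_comm (f := fun x y => cA y x * B x y)]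
    simp only [← Finset.sum_add_distrib]
    refine Finset.sum_congr rfl fun x _ => Finset.sum_congr rfl fun y _ => ?_
    rw [rate_eq hβ]
    simp only [cA, A, B]
    ring
  have hdiss : ∑ x, ∑ y, (chi β x y + sigma β x y) * (ψ y - ψ x) ^ 2
      = 2 * ∑ x, ∑ y, halfDissipation β w x y * (ψ y - ψ x) ^ 2 := by
    simp only [chi_add_sigma hβ, ← hwdef, add_mul, Finset.sum_add_distrib]
    rw [two_mul]
    congr 1
    rw [Finset.sum_comm]
    exact Finset.sum_congr rfl fun x _ => Finset.sum_congr rfl fun y _ => by ring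
  simp only [hI]
  rw [hdiss]
  simp only [Finset.sum_sub_distrib, hdrift]
  ring

/-! ### Comparison with the random walk -/

theorem invMeasure_pos [DecidableEq V] [Nonempty V] {β : V → V → Measure (I × I)}
    (hβ : WellDefined β) (hirr : Irreducible β) (x : V) : 0 < invMeasure β x := by
  obtain ⟨⟨h0, h1⟩, hbal⟩ := invMeasure_spec β
  obtain ⟨a, ha⟩ : ∃ a, 0 < invMeasure β a := by
    by_contra! hcon
    linarith [Finset.sum_nonpos fun x (_ : x ∈ Finset.univ) => hcon x]
  refine balance_pos (rate_nonneg β) (fun x y => ?_) h0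
    (fun x => (balance_iff _ _ x).1 (hbal x)) ha x
  exact (hirr x y).lift id fun a b h => h.2.trans_le (rate₂_le_rate hβ a b)

theorem edgeWeight_nonneg [DecidableEq V] [Nonempty V] (β : V → V → Measure (I × I)) (x y : V) :
    0 ≤ edgeWeight β x y := by
  have h0 := (invMeasure_spec β).1.1
  have h1 := mul_nonneg (h0 x) (rate_nonneg β x y)
  have h2 := mul_nonneg (h0 y) (rate_nonneg β y x)
  unfold edgeWeight
  positivity

theorem dirichletRW_nonneg [DecidableEq V] [Nonempty V] (β : V → V → Measure (I × I))
    (ψ : V → ℝ) : 0 ≤ dirichletRW β ψ :=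
  mul_nonneg (by norm_num) (Finset.sum_nonneg fun x _ => Finset.sum_nonneg fun y _ =>
    mul_nonneg (edgeWeight_nonneg β x y) (sq_nonneg _))

theorem dirichletRW_smul [DecidableEq V] [Nonempty V] (β : V → V → Measure (I × I))
    (s : ℝ) (ψ : V → ℝ) : dirichletRW β (s • ψ) = s ^ 2 * dirichletRW β ψ := by
  simp only [dirichletRW, Pi.smul_apply, smul_eq_mul, Finset.mul_sum]
  exact Finset.sum_congr rfl fun x _ => Finset.sum_congr rfl fun y _ => by ring

theorem chi_add_sigma_nonneg [DecidableEq V] [Nonempty V] (β : V → V → Measure (I × I))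
    (x y : V) : 0 ≤ chi β x y + sigma β x y := by
  have h0 := (invMeasure_spec β).1.1
  refine add_nonneg (integral_nonneg fun p => ?_) (integral_nonneg fun p => sq_nonneg _)
  have h1 : 0 ≤ (p.1 : ℝ) * (1 - (p.1 : ℝ)) := mul_nonneg p.1.2.1 (sub_nonneg.2 p.1.2.2)
  have h2 : 0 ≤ (p.2 : ℝ) * (1 - (p.2 : ℝ)) := mul_nonneg p.2.2.1 (sub_nonneg.2 p.2.2.2)
  exact add_nonneg (mul_nonneg (h0 x) h1) (mul_nonneg (h0 y) h2)

theorem gapRW_mul_wvar_le [DecidableEq V] [Nonempty V] (β : V → V → Measure (I × I))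
    (ψ : V → ℝ) : gapRW β * wvar (invMeasure β) ψ ≤ dirichletRW β ψ := by
  rcases (wvar_nonneg (invMeasure_spec β).1.1 ψ).eq_or_lt with h | h
  · rw [← h, mul_zero]
    exact dirichletRW_nonneg β ψ
  · have hbdd : BddBelow {e | ∃ ψ : V → ℝ, centredNorm β ψ = 1 ∧ e = dirichletRW β ψ} :=
      ⟨0, fun e ⟨φ, _, he⟩ => he ▸ dirichletRW_nonneg β φ⟩
    have hs : (√(wvar (invMeasure β) ψ))⁻¹ ^ 2 = (wvar (invMeasure β) ψ)⁻¹ := by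
      rw [inv_pow, Real.sq_sqrt h.le]
    have hle : gapRW β ≤ dirichletRW β ((√(wvar (invMeasure β) ψ))⁻¹ • ψ) := by
      refine csInf_le hbdd ⟨_, ?_, rfl⟩
      change √(wvar (invMeasure β) _) = 1
      rw [wvar_smul, hs, inv_mul_cancel₀ h.ne', Real.sqrt_one]
    rw [dirichletRW_smul, hs, inv_mul_eq_div] at hle
    exact (le_div_iff₀ h).1 hle

theorem gamma_nonneg [DecidableEq V] [Nonempty V] (β : V → V → Measure (I × I)) :
    0 ≤ gamma β :=
  Real.sInf_nonneg fun _ ⟨x, y, _, hpos, hc⟩ =>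
    hc ▸ div_nonneg (chi_add_sigma_nonneg β x y) hpos.le

theorem gamma_mul_edgeWeight_le [DecidableEq V] [Nonempty V] (β : V → V → Measure (I × I))
    {x y : V} (hxy : x ≠ y) : gamma β * edgeWeight β x y ≤ chi β x y + sigma β x y := by
  rcases (edgeWeight_nonneg β x y).eq_or_lt with h | h
  · rw [← h, mul_zero]
    exact chi_add_sigma_nonneg β x y
  · refine (le_div_iff₀ h).1 (csInf_le ⟨0, ?_⟩ ⟨x, y, hxy, h, rfl⟩)
    rintro _ ⟨a, b, -, hpos, rfl⟩
    exact div_nonneg (chi_add_sigma_nonneg β a b) hpos.le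

/-- The dissipation rate of the variance dominates `γ` times the Dirichlet form of the random walk,
hence `γ * gap` times the variance. -/
theorem gamma_mul_gapRW_mul_wvar_le [DecidableEq V] [Nonempty V] (β : V → V → Measure (I × I))
    (ψ : V → ℝ) : gamma β * gapRW β * wvar (invMeasure β) ψ
      ≤ 1 / 2 * ∑ x, ∑ y, (chi β x y + sigma β x y) * (ψ y - ψ x) ^ 2 := by
  calc gamma β * gapRW β * wvar (invMeasure β) ψ
      ≤ gamma β * dirichletRW β ψ := by
        rw [mul_assoc]
        exact mul_le_mul_of_nonneg_left (gapRW_mul_wvar_le β ψ) (gamma_nonneg β)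
    _ = 1 / 2 * ∑ x, ∑ y, gamma β * edgeWeight β x y * (ψ y - ψ x) ^ 2 := by
        rw [dirichletRW, mul_left_comm, Finset.mul_sum]
        simp only [Finset.mul_sum, mul_assoc]
    _ ≤ _ := by
        refine mul_le_mul_of_nonneg_left (Finset.sum_le_sum fun x _ => Finset.sum_le_sum
          fun y _ => ?_) (by norm_num)
        rcases eq_or_ne x y with rfl | hxy
        · simp
        · exact mul_le_mul_of_nonneg_right (gamma_mul_edgeWeight_le β hxy) (sq_nonneg _)

/-! ### The maximum principle -/

theorem mix_mem_Icc {V : Type*} [DecidableEq V] (x y : V) (u v : I) {ψ : V → ℝ}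
    (hψ : ∀ z, ψ z ∈ Set.Icc (0 : ℝ) 1) (z : V) : mix x y u v ψ z ∈ Set.Icc (0 : ℝ) 1 := by
  have hconv : ∀ (t : I) (a b : V), ψ a + (1 - (t : ℝ)) * (ψ b - ψ a) ∈ Set.Icc (0 : ℝ) 1 := by
    intro t a b
    have := (convex_Icc (0 : ℝ) 1) (hψ a) (hψ b) t.2.1 (sub_nonneg.2 t.2.2) (by ring)
    convert this using 1
    simp only [smul_eq_mul]
    ring
  rcases eq_or_ne x y with rfl | hxy
  · simpa [mix] using hψ z
  · by_cases hzx : z = x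
    · subst hzx
      simpa [mix, hxy] using hconv u z y
    · by_cases hzy : z = y
      · subst hzy
        simpa [mix, hzx] using hconv v z x
      · simpa [mix, hzx, hzy] using hψ z

/-- The functions `V → [0, 1]` that attain both `0` and `1`. -/
def normalized (V : Type*) : Set (V → ℝ) :=
  {ψ | (∀ z, ψ z ∈ Set.Icc (0 : ℝ) 1) ∧ (∃ x, ψ x = 0) ∧ ∃ y, ψ y = 1}

theorem isCompact_normalized : IsCompact (normalized V) := by
  have hbox : IsCompact (Set.pi Set.univ fun _ : V => Set.Icc (0 : ℝ) 1) :=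
    isCompact_univ_pi fun _ => isCompact_Icc
  have hcl : ∀ t : ℝ, IsClosed {ψ : V → ℝ | ∃ x, ψ x = t} := by
    intro t
    rw [Set.ofPred_exists]
    exact isClosed_iUnion_of_finite fun x => isClosed_eq (continuous_apply x) continuous_const
  convert hbox.inter_right ((hcl 0).inter (hcl 1)) using 1
  ext ψ
  rw [Set.mem_inter_iff, Set.mem_univ_pi]
  rfl

/-- Every function on `V` is an affine image of a normalized one, unless it is constant. -/
theorem exists_normalized [Nonempty V] (ψ : V → ℝ) :
    (∃ t, ψ = fun _ => t) ∨ ∃ φ ∈ normalized V, ∃ s t x y : _, s = ψ y - ψ x ∧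
      ψ = fun z => (s • φ) z + t := by
  obtain ⟨x, hx⟩ := Finite.exists_min ψ
  obtain ⟨y, hy⟩ := Finite.exists_max ψ
  rcases (hx y).eq_or_lt with h | h
  · exact .inl ⟨ψ x, funext fun z => le_antisymm (h ▸ hy z) (hx z)⟩
  · have hs : 0 < ψ y - ψ x := sub_pos.2 h
    refine .inr ⟨fun z => (ψ z - ψ x) / (ψ y - ψ x), ⟨fun z => ⟨?_, ?_⟩, ⟨x, by simp⟩,
      ⟨y, div_self hs.ne'⟩⟩, _, ψ x, x, y, rfl, ?_⟩
    · exact div_nonneg (sub_nonneg.2 (hx z)) hs.le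
    · exact (div_le_one hs).2 (sub_le_sub_right (hy z) _)
    · ext z
      simp only [Pi.smul_apply, smul_eq_mul]
      field_simp
      ring

/-- A nonzero continuous function `P` on `ℝ^V` that is homogeneous of degree `k ≥ 2` and invariant
under the addition of constants is, on `[0, 1]^V`, bounded by a multiple of the variance, with
equality at some `ψ` where `P` does not vanish. -/
theorem exists_extremal [Nontrivial V] [DecidableEq V] {w : V → ℝ} (hw : ∀ x, 0 < w x)
    (hw1 : ∑ x, w x = 1) {k : ℕ} (hk : 2 ≤ k) {P : (V → ℝ) → ℂ} (hcont : Continuous P)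
    (hhom : ∀ (s : ℝ) ψ, P (s • ψ) = (s : ℂ) ^ k * P ψ)
    (hshift : ∀ (t : ℝ) ψ, P (fun z => ψ z + t) = P ψ) (hne : ∃ ψ, P ψ ≠ 0) :
    ∃ C : ℝ, ∃ ψ : V → ℝ, 0 ≤ C ∧ (∀ z, ψ z ∈ Set.Icc (0 : ℝ) 1) ∧ 0 < ‖P ψ‖ ∧
      ‖P ψ‖ = C * wvar w ψ ∧
      ∀ φ : V → ℝ, (∀ z, φ z ∈ Set.Icc (0 : ℝ) 1) → ‖P φ‖ ≤ C * wvar w φ := by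
  have hP0 : ∀ t : ℝ, P (fun _ => t) = 0 := by
    intro t
    have h1 := hshift t ((0 : ℝ) • (0 : V → ℝ))
    have h2 := hhom 0 0
    rw [Complex.ofReal_zero, zero_pow (by omega), zero_mul] at h2
    rw [h2] at h1
    simpa using h1
  obtain ⟨φ₁, hφ₁, hPφ₁⟩ : ∃ φ ∈ normalized V, P φ ≠ 0 := by
    obtain ⟨ψ, hψ⟩ := hne
    rcases exists_normalized ψ with ⟨t, rfl⟩ | ⟨φ, hφ, s, t, -, -, -, rfl⟩
    · exact absurd (hP0 t) hψ
    · refine ⟨φ, hφ, fun h => hψ ?_⟩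
      rw [hshift, hhom, h, mul_zero]
  have hpos : ∀ φ ∈ normalized V, 0 < wvar w φ := by
    rintro φ ⟨-, ⟨x, hx⟩, y, hy⟩
    exact wvar_pos hw (x := x) (y := y) (by rw [hx, hy]; exact zero_ne_one)
  have hcv : Continuous (wvar w) := by
    unfold wvar
    fun_prop
  obtain ⟨ψ, hψ, hmax⟩ := isCompact_normalized.exists_isMaxOn ⟨φ₁, hφ₁⟩
    (f := fun φ => ‖P φ‖ / wvar w φ)
    (hcont.norm.continuousOn.div hcv.continuousOn fun φ hφ => (hpos φ hφ).ne')
  set C := ‖P ψ‖ / wvar w ψ with hC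
  have hCpos : 0 < C :=
    (div_pos (norm_pos_iff.2 hPφ₁) (hpos φ₁ hφ₁)).trans_le (hmax hφ₁)
  have heq : ‖P ψ‖ = C * wvar w ψ := (div_mul_cancel₀ _ (hpos ψ hψ).ne').symm
  refine ⟨C, ψ, hCpos.le, hψ.1, heq ▸ mul_pos hCpos (hpos ψ hψ), heq, fun φ hφ => ?_⟩
  rcases exists_normalized φ with ⟨t, rfl⟩ | ⟨φ', hφ', s, t, x, y, hs, hφeq⟩
  · rw [hP0, norm_zero]
    exact mul_nonneg hCpos.le (wvar_nonneg (fun x => (hw x).le) _)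
  · have hs1 : |s| ≤ 1 := by
      rw [hs, abs_le]
      constructor <;> linarith [(hφ x).1, (hφ x).2, (hφ y).1, (hφ y).2]
    have h' : ‖P φ'‖ ≤ C * wvar w φ' := (div_le_iff₀ (hpos φ' hφ')).1 (hmax hφ')
    -- The oscillation `s` of `φ` is at most one, so `|s| ^ k ≤ s ^ 2`; here `2 ≤ k` enters.
    have hsk : |s| ^ k ≤ s ^ 2 := by
      rw [← sq_abs]
      exact pow_le_pow_of_le_one (abs_nonneg s) hs1 hk
    rw [hφeq, hshift, hhom, wvar_add_const hw1, wvar_smul, norm_mul, norm_pow, Complex.norm_real,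
      Real.norm_eq_abs]
    calc |s| ^ k * ‖P φ'‖ ≤ s ^ 2 * (C * wvar w φ') :=
          mul_le_mul hsk h' (norm_nonneg _) (sq_nonneg s)
      _ = C * (s ^ 2 * wvar w φ') := by ring

end StochasticExchange

open StochasticExchange in
theorem mainTheorem1 {V : Type*} [Fintype V] [DecidableEq V] [Nontrivial V]
    (β : V → V → MeasureTheory.Measure (unitInterval × unitInterval))
    (hβ : StochasticExchange.WellDefined β) (hirr : StochasticExchange.Irreducible β)
    (k : ℕ) (hk : 2 ≤ k) (lam : ℂ)
    (hlam : StochasticExchange.IsEigenvalueNegGenerator β k lam)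
    (hlam' : ¬ StochasticExchange.IsEigenvalueNegGenerator β (k - 1) lam) :
    StochasticExchange.gamma β * StochasticExchange.gapRW β ≤ lam.re := by
  obtain ⟨P, hcont, hhom, hshift, hne, hint, heig⟩ :=
    exists_dual_eigenfunction hβ (by omega) hlam hlam'
  obtain ⟨C, ψ, hC, hψ, hpos, heq, hle⟩ := exists_extremal (invMeasure_pos hβ hirr)
    (invMeasure_spec β).1.2 hk hcont hhom hshift hne
  obtain ⟨hvint, hvar⟩ := integral_wvar_mix_sub hβ ψ
  -- Rotating by the phase of `P ψ` makes the extremal value positive.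
  set θ : ℂ := (starRingEnd ℂ) (P ψ) / ‖P ψ‖ with hθ
  have hθnorm : ‖θ‖ = 1 := by
    rw [hθ, norm_div, RCLike.norm_conj, Complex.norm_real, norm_norm, div_self hpos.ne']
  have hθP : θ * P ψ = (‖P ψ‖ : ℂ) := by
    have h0 : (‖P ψ‖ : ℂ) ≠ 0 := Complex.ofReal_ne_zero.2 hpos.ne'
    rw [hθ, div_mul_eq_mul_div, mul_comm, Complex.mul_conj, Complex.normSq_eq_norm_sq,
      Complex.ofReal_pow, sq, mul_div_assoc, div_self h0, mul_one]
  -- The extremal inequality holds after every update, since updates preserve `[0, 1]^V`.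
  have hpt : ∀ x y (p : I × I), (θ * (P (mix x y p.1 p.2 ψ) - P ψ)).re
      ≤ C * (wvar (invMeasure β) (mix x y p.1 p.2 ψ) - wvar (invMeasure β) ψ) := by
    intro x y p
    have h1 : (θ * P (mix x y p.1 p.2 ψ)).re ≤ ‖P (mix x y p.1 p.2 ψ)‖ := by
      refine (Complex.re_le_norm _).trans ?_
      rw [norm_mul, hθnorm, one_mul]
    have h2 := hle _ (mix_mem_Icc x y p.1 p.2 hψ)
    rw [mul_sub, hθP, Complex.sub_re, Complex.ofReal_re, mul_sub, ← heq]
    linarith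
  have hxy : ∀ x y, (θ * ∫ p, (P (mix x y p.1 p.2 ψ) - P ψ) ∂(β x y)).re
      ≤ C * ∫ p, (wvar (invMeasure β) (mix x y p.1 p.2 ψ) - wvar (invMeasure β) ψ) ∂(β x y) := by
    intro x y
    have hi := (hint x y ψ).const_mul θ
    have hre : ∫ p, (θ * (P (mix x y p.1 p.2 ψ) - P ψ)).re ∂(β x y)
        = (∫ p, θ * (P (mix x y p.1 p.2 ψ) - P ψ) ∂(β x y)).re := integral_re hi
    rw [← integral_const_mul, ← hre, ← integral_const_mul]
    exact integral_mono hi.re ((hvint x y).const_mul C) (hpt x y)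
  -- The dual eigenvalue equation is on the left, the dissipation of the variance on the right.
  have hsum := Finset.sum_le_sum fun x (_ : x ∈ Finset.univ) =>
    Finset.sum_le_sum fun y (_ : y ∈ Finset.univ) => hxy x y
  simp only [← Finset.mul_sum, ← Complex.re_sum] at hsum
  rw [heig ψ, hvar, mul_left_comm, hθP, Complex.re_mul_ofReal, Complex.neg_re] at hsum
  have hdiss := mul_le_mul_of_nonneg_left (gamma_mul_gapRW_mul_wvar_le β ψ) hC
  refine le_of_mul_le_mul_right ?_ hpos
  calc gamma β * gapRW β * ‖P ψ‖ = C * (gamma β * gapRW β * wvar (invMeasure β) ψ) := by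
        rw [heq]
        ring
    _ ≤ lam.re * ‖P ψ‖ := by linarith
end
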